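/- Let $\Sigma$ be a vocabulary consisting of finitely many constants and of predicate symbols, with no function symbols of positive arity; equality is available as a logical symbol. Let $\sigma \subseteq \Sigma$. Structures are nonempty and may be infinite. Formulas may have finitely many free variables $\mathbf{x}$; sentences are the case of no free variables. **$\mathbf{EBS}(\Sigma,\sigma)$.** A first-order $\Sigma$-formula $\varphi(\mathbf{x})$ belongs to $\mathbf{EBS}(\Sigma,\sigma)$ if there is $\mathcal{B} \in \mathbb{N}$, depending only on $\varphi$, such that for every $\Sigma$-structure $M$ and tuple $\mathbf{a}$ with $M \models \varphi(\mathbf{a})$ there is a (nonempty) substructure $M_1 \subseteq M$ containing $\mathbf{a}$ with $|M_1| \le \mathcal{B}$ such that for every substructure $M_2$ with $M_1 \subseteq M_2 \subseteq M$ there is a $\Sigma$-structure $M_2'$ with the same universe as $M_2$, with $M_2'|_\sigma = M_2|_\sigma$ and $M_2' \models \varphi(\mathbf{a})$. **$\mathbf{EDP}(\Sigma,\sigma)$.** Let $\varphi(\mathbf{x})$ be in prenex normal form with quantifier-free matrix $\psi$ in CNF. Let $V$ consist of the free variables and the variables bound by the leftmost block of existential quantifiers, let $AV$ be the set of universally quantified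 variables, and let $EV$ be the set of the remaining existentially quantified variables (those in the scope of some universal quantifier). An argument of an instance of a predicate in $\psi$ is *free* if it is a constant or belongs to $V$, *universal* if it belongs to $AV$, and *existential* if it belongs to $EV$. A predicate is *free or universal* in $\varphi$ if none of its instances in $\psi$ has an existential argument, and *existential* in $\varphi$ if some instance does. Let $E_{\mathsf U} \subseteq EV$ be the set of the variables of $EV$ that occur as the argument of an instance of a unary predicate, and let $\overline{E_{\mathsf U}} = EV \setminus E_{\mathsf U}$. Two instances of a predicate are *existentially distinguishable by* $v$ if for some $i$ the variable $v$ is the $i$-th argument of one of them, while the $i$-th argument of the other is not universal and is different from $v$. The formula $\varphi$ belongs to $\mathbf{EDP}(\Sigma,\sigma)$ if 1. every predicate of arity at least $2$ in $\sigma \cup \{=\}$ is free or universal in $\varphi$; and 2. whenever $P \in \Sigma$ is an existential predicate of arity at least $2$, any two instances of $P$ of opposite polarity in different clauses of $\psi$ are existentially distinguishable by some $v \in \overline{E_{\mathsf U}}$. **Corollary.** For every $\sigma \subseteq \Sigma$, $\mathbf{EDP}(\Sigma,\sigma) \subseteq \mathbf{EBS}(\Sigma,\sigma)$. -/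

import Mathlib

universe u v w z

namespace FirstOrder.Language

/-! ### The semantic class `EBS` -/

/-- Two structures on the same universe have the same reduct to the set `σ` of symbols. -/
def AgreeOn {L : Language.{u, v}} {X : Type z} (σ : Set L.Symbols) (S T : L.Structure X) : Prop :=
  (∀ (k : ℕ) (f : L.Functions k), Sum.inl ⟨k, f⟩ ∈ σ →
      @Structure.funMap L X S k f = @Structure.funMap L X T k f) ∧
  (∀ (k : ℕ) (R : L.Relations k), Sum.inr ⟨k, R⟩ ∈ σ →
      @Structure.RelMap L X S k R = @Structure.RelMap L X T k R)

/-- The class `EBS(Σ, σ)`, for formulas with free variables indexed by `α`; sentences are the case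
`α = Empty`. There is a bound `B`, depending only on `φ`, such that every model `(M, a)` of `φ` has
a substructure `M₁` containing `a` with at most `B` elements, such that every `M₂` with
`M₁ ⊆ M₂ ⊆ M` can be turned into a model of `φ(a)` by changing only the interpretations of symbols
outside `σ`. Structures are nonempty; `M` may be infinite. -/
def EBS (L : Language.{u, v}) (σ : Set L.Symbols) (α : Type w) : Set (L.Formula α) :=
  {φ | ∃ B : ℕ, ∀ (M : Type z) [L.Structure M] [Nonempty M] (a : α → M), φ.Realize a →
    ∃ (M₁ : L.Substructure M) (ha : ∀ x, a x ∈ M₁),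
      (M₁ : Set M).Nonempty ∧ (M₁ : Set M).encard ≤ B ∧
      ∀ (M₂ : L.Substructure M) (h : M₁ ≤ M₂), ∃ S' : L.Structure M₂,
        AgreeOn σ S' Substructure.inducedStructure ∧
        @Formula.Realize L M₂ S' α φ (fun x => ⟨a x, h (ha x)⟩)}

/-! ### Formulas in prenex conjunctive normal form -/

/-- The two quantifiers. -/
inductive Quant : Type
  | all
  | ex

/-- Instances of predicates (including equality) whose variables are the free variables `α` and
the bound variables `Fin n`. -/
inductive PredInst (L : Language.{u, v}) (α : Type w) (n : ℕ) : Type max u v w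
  | rel {k : ℕ} (R : L.Relations k) (ts : Fin k → L.Term (α ⊕ Fin n))
  | eq (s t : L.Term (α ⊕ Fin n))

/-- A literal: an instance of a predicate with a polarity (`true` is positive). -/
structure Literal (L : Language.{u, v}) (α : Type w) (n : ℕ) : Type max u v w where
  pred : PredInst L α n
  pol : Bool

/-- Formulas in prenex conjunctive normal form. The bound variables are `0, …, n - 1`, in the order
of the quantifier prefix: variable `i` is bound by the quantifier `quant i`. -/
structure PCNF (L : Language.{u, v}) (α : Type w) : Type max u v w where
  n : ℕ
  quant : Fin n → Quant
  matrix : List (List (Literal L α n))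

variable {L : Language.{u, v}} {α : Type w}

def PredInst.toFormula {n : ℕ} : PredInst L α n → L.BoundedFormula α n
  | .rel R ts => .rel R ts
  | .eq s t => .equal s t

def Literal.toFormula {n : ℕ} (l : Literal L α n) : L.BoundedFormula α n :=
  match l.pol with
  | true => l.pred.toFormula
  | false => l.pred.toFormula.not

def clauseFormula {n : ℕ} (C : List (Literal L α n)) : L.BoundedFormula α n :=
  (C.map Literal.toFormula).foldr (· ⊔ ·) ⊥

def matrixFormula {n : ℕ} (ψ : List (List (Literal L α n))) : L.BoundedFormula α n :=
  (ψ.map clauseFormula).foldr (· ⊓ ·) ⊤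

/-- `(q 0) x₀ (q 1) x₁ … (q (n - 1)) xₙ₋₁, ψ`. -/
def closeWith : (n : ℕ) → (Fin n → Quant) → L.BoundedFormula α n → L.Formula α
  | 0, _, ψ => ψ
  | n + 1, q, ψ => closeWith n (fun i => q i.castSucc)
      (match q (Fin.last n) with
        | .all => ψ.all
        | .ex => ψ.ex)

namespace PCNF

/-- The first-order formula that a prenex conjunctive normal form denotes. -/
def toFormula (p : PCNF L α) : L.Formula α :=
  closeWith p.n p.quant (matrixFormula p.matrix)

variable (p : PCNF L α)

/-- Universally quantified variables. -/
def AV : Set (Fin p.n) := {i | p.quant i = .all}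

/-- Variables bound by the leftmost block of existential quantifiers. -/
def Leftmost : Set (Fin p.n) := {i | p.quant i = .ex ∧ ∀ j < i, p.quant j = .ex}

/-- The other existentially quantified variables, each in the scope of a universal quantifier. -/
def EV : Set (Fin p.n) := {i | p.quant i = .ex ∧ ∃ j < i, p.quant j = .all}

/-- Free arguments: free variables, leftmost existential variables, and constants. -/
def IsFreeArg (t : L.Term (α ⊕ Fin p.n)) : Prop :=
  (∃ x : α, t = .var (.inl x)) ∨ (∃ i ∈ p.Leftmost, t = .var (.inr i)) ∨
    ∃ c : L.Constants, t = c.term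

/-- Universal arguments. -/
def IsUnivArg (t : L.Term (α ⊕ Fin p.n)) : Prop := ∃ i ∈ p.AV, t = .var (.inr i)

/-- Existential arguments. -/
def IsExArg (t : L.Term (α ⊕ Fin p.n)) : Prop := ∃ i ∈ p.EV, t = .var (.inr i)

/-- The predicate instance `I` occurs, with polarity `b`, in the clause number `c`. -/
def OccursIn (c : Fin p.matrix.length) (I : PredInst L α p.n) (b : Bool) : Prop :=
  (⟨I, b⟩ : Literal L α p.n) ∈ p.matrix.get c

/-- The predicate instance `I` occurs in the matrix. -/
def Occurs (I : PredInst L α p.n) : Prop := ∃ c b, p.OccursIn c I b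

/-- The variables of `EV` that occur as the argument of an instance of a unary predicate. -/
def EU : Set (Fin p.n) :=
  {i | i ∈ p.EV ∧ ∃ (R : L.Relations 1) (ts : Fin 1 → L.Term (α ⊕ Fin p.n)),
    p.Occurs (.rel R ts) ∧ ts 0 = .var (.inr i)}

/-- The complement of `EU` in `EV`. -/
def EUc : Set (Fin p.n) := p.EV \ p.EU

/-- `R` is a free or universal predicate: no instance has an existential argument. -/
def IsFreeOrUniv {k : ℕ} (R : L.Relations k) : Prop :=
  ∀ ts, p.Occurs (.rel R ts) → ∀ j, p.IsFreeArg (ts j) ∨ p.IsUnivArg (ts j)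

/-- Equality is a free or universal predicate. -/
def EqIsFreeOrUniv : Prop :=
  ∀ s t, p.Occurs (.eq s t) →
    (p.IsFreeArg s ∨ p.IsUnivArg s) ∧ (p.IsFreeArg t ∨ p.IsUnivArg t)

/-- `R` is an existential predicate: some instance has an existential argument. -/
def IsExistential {k : ℕ} (R : L.Relations k) : Prop :=
  ∃ ts, p.Occurs (.rel R ts) ∧ ∃ j, p.IsExArg (ts j)

/-- Two instances of a predicate (given by their argument vectors) are existentially
distinguishable by the variable `i`: at some position, one has `i` as its argument, and the other
has an argument that is different from `i` and is not universal. -/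
def Distinguishable {k : ℕ} (i : Fin p.n) (ts ts' : Fin k → L.Term (α ⊕ Fin p.n)) : Prop :=
  ∃ j, (ts j = .var (.inr i) ∧ ts' j ≠ .var (.inr i) ∧ ¬ p.IsUnivArg (ts' j)) ∨
    (ts' j = .var (.inr i) ∧ ts j ≠ .var (.inr i) ∧ ¬ p.IsUnivArg (ts j))

/-- The syntactic conditions that define `EDP(Σ, σ)`. -/
structure IsEDP (σ : Set L.Symbols) : Prop where
  eq_freeOrUniv : p.EqIsFreeOrUniv
  freeOrUniv : ∀ (k : ℕ) (R : L.Relations k), 2 ≤ k → Sum.inr ⟨k, R⟩ ∈ σ → p.IsFreeOrUniv R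
  distinguishable : ∀ (k : ℕ) (R : L.Relations k), 2 ≤ k → p.IsExistential R →
    ∀ (c c' : Fin p.matrix.length) (ts ts' : Fin k → L.Term (α ⊕ Fin p.n)), c ≠ c' →
      p.OccursIn c (.rel R ts) true → p.OccursIn c' (.rel R ts') false →
        ∃ i ∈ p.EUc, p.Distinguishable i ts ts'

end PCNF

/-- The class `EDP(Σ, σ)`, for formulas with free variables indexed by `α`. -/
def EDP (L : Language.{u, v}) (σ : Set L.Symbols) (α : Type w) : Set (L.Formula α) :=
  {φ | ∃ p : PCNF L α, p.toFormula = φ ∧ p.IsEDP σ}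

end FirstOrder.Language

/-! Fix witnesses `z` for the leftmost existential block. The core `M₁` consists of the values of
`a`, `z` and the constants, one representative of each realized unary type, and one fresh element `e
i` per bound variable, distinct from all of these. If `M` is too small to supply fresh elements, `M₁
= M` works.

In `M₂ ⊇ M₁`, universal variables are answered as in `M`. A variable of `EU` takes the
representative of the unary type of its witness in `M`; a variable `i` of `EUc` always takes `e i`.
Existential predicates of arity at least 2 (the flexible ones) lie outside `σ` and are redefined:
each clause containing a flexible literal chooses one, and a flexible predicate holds exactly at the
tuples forced by chosen positive literals. Chosen negative literals then hold too, since
distinguishability makes some `e i` separate their tuples from the forced ones. A clause without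
flexible literals keeps the literal that was true in `M`: its arguments have the same values, or its
predicate is unary and the type is preserved (`realize_matrix`). `QuantClosure.transfer` carries
this through the prefix. -/

namespace FirstOrder.Language

/-! ### Semantics of quantifier prefixes -/

/-- The truth value of `(q 0) x₀ … (q (n - 1)) xₙ₋₁, P x` over the universe `M`. -/
def QuantClosure {M : Type*} : (n : ℕ) → (Fin n → Quant) → ((Fin n → M) → Prop) → Prop
  | 0, _, P => P default
  | n + 1, q, P => QuantClosure n (fun i => q i.castSucc) fun x =>
      match q (Fin.last n) with
      | .all => ∀ m : M, P (Fin.snoc (α := fun _ => M) x m)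
      | .ex => ∃ m : M, P (Fin.snoc (α := fun _ => M) x m)

theorem realize_closeWith {L : Language.{u, v}} {α : Type w} {M : Type*} [L.Structure M]
    (a : α → M) {n : ℕ} (q : Fin n → Quant) (ψ : L.BoundedFormula α n) :
    (closeWith n q ψ).Realize a ↔ QuantClosure n q fun x => ψ.Realize a x := by
  induction n with
  | zero => rfl
  | succ n ih =>
    simp only [closeWith, QuantClosure]
    rw [ih]
    cases q (Fin.last n) <;> simp

namespace QuantClosure

variable {M N : Type*}

theorem mono {n : ℕ} {q : Fin n → Quant} {P P' : (Fin n → M) → Prop}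
    (h : QuantClosure n q P) (hP : ∀ x, P x → P' x) : QuantClosure n q P' := by
  induction n with
  | zero => exact hP _ h
  | succ n ih =>
    refine ih h fun x => ?_
    cases q (Fin.last n)
    · exact fun h m => hP _ (h m)
    · exact fun ⟨m, hm⟩ => ⟨m, hP _ hm⟩

theorem exists_of [Nonempty M] {n : ℕ} {q : Fin n → Quant} {P : (Fin n → M) → Prop}
    (h : QuantClosure n q P) : ∃ x, P x := by
  induction n with
  | zero => exact ⟨_, h⟩
  | succ n ih =>
    obtain ⟨x, hx⟩ := ih h
    cases hq : q (Fin.last n) <;> rw [hq] at hx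
    · exact ⟨_, hx (Classical.arbitrary M)⟩
    · exact ⟨_, hx.choose_spec⟩

/-- The witnesses of the leftmost block of existential quantifiers can be fixed in advance. -/
theorem exists_leftmost [Nonempty M] {n : ℕ} {q : Fin n → Quant} {P : (Fin n → M) → Prop}
    (h : QuantClosure n q P) :
    ∃ z : Fin n → M, QuantClosure n q fun x =>
      P x ∧ ∀ i, (q i = .ex ∧ ∀ j < i, q j = .ex) → x i = z i := by
  induction n with
  | zero => exact ⟨default, h, fun i => i.elim0⟩
  | succ n ih =>
    obtain ⟨z, hz⟩ := ih h
    have lift : ∀ i : Fin n, (q i.castSucc = .ex ∧ ∀ j < i.castSucc, q j = .ex) →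
        q i.castSucc = .ex ∧ ∀ j < i, q j.castSucc = .ex :=
      fun i hi => ⟨hi.1, fun j hj => hi.2 _ (Fin.castSucc_lt_castSucc_iff.2 hj)⟩
    -- If the last variable is in the leftmost block, the whole prefix is existential, so `z` pins
    -- the assignment completely and one witness `m` serves. Otherwise the last entry of `z` is
    -- irrelevant.
    by_cases hl : q (Fin.last n) = .ex ∧ ∀ j < Fin.last n, q j = .ex
    · have all_ex : ∀ i : Fin n, q i.castSucc = .ex := fun i => hl.2 _ i.castSucc_lt_last
      obtain ⟨x, hx, hxz⟩ := exists_of hz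
      obtain rfl : x = z := funext fun i => hxz i ⟨all_ex i, fun j _ => all_ex j⟩
      rw [hl.1] at hx
      obtain ⟨m, hm⟩ := hx
      refine ⟨Fin.snoc (α := fun _ => M) x m, mono (n := n) hz fun y hy => ?_⟩
      obtain rfl : y = x := funext fun i => hy.2 i ⟨all_ex i, fun j _ => all_ex j⟩
      rw [hl.1]
      exact ⟨m, hm, fun _ _ => rfl⟩
    · refine ⟨Fin.snoc (α := fun _ => M) z (Classical.arbitrary M), mono (n := n) hz fun y hy => ?_⟩
      have key : ∀ m : M, ∀ i, (q i = .ex ∧ ∀ j < i, q j = .ex) →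
          (Fin.snoc (α := fun _ => M) y m : Fin (n + 1) → M) i =
            Fin.snoc (α := fun _ => M) z (Classical.arbitrary M) i := by
        intro m i
        refine Fin.lastCases (fun hi => absurd hi hl) (fun i hi => ?_) i
        simpa using hy.2 i (lift i hi)
      obtain ⟨hy, -⟩ := hy
      cases hq : q (Fin.last n) <;> rw [hq] at hy
      · exact fun m => ⟨hy m, key m⟩
      · exact ⟨hy.choose, hy.choose_spec, key _⟩

/-- Transfer of a quantified statement along a relation that is total in the direction that each
quantifier requires. -/
theorem transfer {n : ℕ} {q : Fin n → Quant} {P : (Fin n → M) → Prop} {P' : (Fin n → N) → Prop}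
    (r : Fin n → M → N → Prop)
    (hall : ∀ i, q i = .all → ∀ y, ∃ x, r i x y) (hex : ∀ i, q i = .ex → ∀ x, ∃ y, r i x y)
    (hP : ∀ x y, (∀ i, r i (x i) (y i)) → P x → P' y)
    (h : QuantClosure n q P) : QuantClosure n q P' := by
  induction n with
  | zero => exact hP _ _ (fun i => i.elim0) h
  | succ n ih =>
    refine ih (fun i => r i.castSucc) (fun i => hall _) (fun i => hex _) (fun x y hxy => ?_) h
    have key : ∀ s t, r (Fin.last n) s t → ∀ i, r i (Fin.snoc (α := fun _ => M) x s i)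
        (Fin.snoc (α := fun _ => N) y t i) := by
      intro s t hst i
      refine Fin.lastCases (by simpa using hst) (fun i => ?_) i
      simpa using hxy i
    cases hq : q (Fin.last n)
    · intro hx t
      obtain ⟨s, hs⟩ := hall _ hq t
      exact hP _ _ (key s t hs) (hx s)
    · rintro ⟨s, hs⟩
      obtain ⟨t, ht⟩ := hex _ hq s
      exact ⟨t, hP _ _ (key s t ht) hs⟩

end QuantClosure

/-! ### Truth of a CNF matrix; supply of fresh elements -/

theorem realize_matrixFormula {L : Language.{u, v}} {α : Type w} {M : Type*} [L.Structure M]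
    {n : ℕ} (ψ : List (List (Literal L α n))) (a : α → M) (x : Fin n → M) :
    (matrixFormula ψ).Realize a x ↔ ∀ C ∈ ψ, ∃ l ∈ C, l.toFormula.Realize a x := by
  simp [matrixFormula, clauseFormula, BoundedFormula.realize_foldr_inf,
    BoundedFormula.realize_foldr_sup]

theorem exists_injective_avoiding {M : Type*} {T : Type*} [Finite T] (f : T → M) (n : ℕ)
    (h : ¬ (Set.univ : Set M).encard ≤ (Nat.card T + n : ℕ)) :
    ∃ e : Fin n → M, Function.Injective e ∧ ∀ i t, e i ≠ f t := by
  have hf : (Set.range f).encard ≤ (Nat.card T : ℕ) := by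
    rw [← Set.image_univ]
    refine (Set.encard_image_le _ _).trans ?_
    rw [Set.encard_univ, ENat.card_eq_coe_natCard]
  have hn : (n : ℕ∞) ≤ (Set.range f)ᶜ.encard := by
    by_contra! hlt
    refine h ?_
    rw [← Set.encard_add_encard_compl (Set.range f)]
    push_cast
    exact add_le_add hf hlt.le
  obtain ⟨s, hs, hsn⟩ := Set.exists_subset_encard_eq hn
  have : Finite s := Set.finite_of_encard_eq_coe hsn
  have hcard : Nat.card s = n := by
    rw [Nat.card_coe_set_eq, Set.ncard, hsn]; rfl
  refine ⟨fun i => ((Finite.equivFinOfCardEq hcard).symm i : M),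
    Subtype.val_injective.comp (Finite.equivFinOfCardEq hcard).symm.injective, fun i t hit => ?_⟩
  exact hs (Subtype.coe_prop ((Finite.equivFinOfCardEq hcard).symm i)) ⟨t, hit.symm⟩

/-! ### Classification of variables, arguments and predicates -/

namespace PCNF

variable {L : Language.{u, v}} {α : Type w} (p : PCNF L α)

theorem mem_AV_or_Leftmost_or_EV (i : Fin p.n) : i ∈ p.AV ∨ i ∈ p.Leftmost ∨ i ∈ p.EV := by
  simp only [AV, Leftmost, EV, Set.mem_ofPred_eq]
  cases h : p.quant i
  · exact .inl rfl
  · by_cases h' : ∀ j < i, p.quant j = .ex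
    · exact .inr (.inl ⟨rfl, h'⟩)
    · push Not at h'
      obtain ⟨j, hj, hq⟩ := h'
      refine .inr (.inr ⟨rfl, j, hj, ?_⟩)
      cases hj' : p.quant j
      · rfl
      · exact absurd hj' hq

theorem isFreeArg_or_isUnivArg_or_isExArg [∀ k, IsEmpty (L.Functions (k + 1))]
    (t : L.Term (α ⊕ Fin p.n)) : p.IsFreeArg t ∨ p.IsUnivArg t ∨ p.IsExArg t := by
  match t with
  | .var (.inl x) => exact .inl (.inl ⟨x, rfl⟩)
  | .var (.inr i) =>
    rcases p.mem_AV_or_Leftmost_or_EV i with h | h | h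
    · exact .inr (.inl ⟨i, h, rfl⟩)
    · exact .inl (.inr (.inl ⟨i, h, rfl⟩))
    · exact .inr (.inr ⟨i, h, rfl⟩)
  | .func (l := 0) c ts =>
    exact .inl (.inr (.inr ⟨c, congrArg (Term.func c) (Subsingleton.elim _ _)⟩))
  | .func (l := k + 1) f _ => exact isEmptyElim f

theorem isFreeOrUniv_of_not_isExistential [∀ k, IsEmpty (L.Functions (k + 1))] {k : ℕ}
    {R : L.Relations k} (h : ¬ p.IsExistential R) : p.IsFreeOrUniv R := by
  intro ts hts j
  rcases p.isFreeArg_or_isUnivArg_or_isExArg (ts j) with h' | h' | h'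
  · exact .inl h'
  · exact .inr h'
  · exact absurd ⟨ts, hts, j, h'⟩ h

theorem not_isFreeOrUniv_of_isExistential {k : ℕ} {R : L.Relations k} (h : p.IsExistential R) :
    ¬ p.IsFreeOrUniv R := by
  obtain ⟨ts, hts, j, i, hi, hj⟩ := h
  intro h
  rcases h ts hts j with (⟨x, hx⟩ | ⟨i', hi', hx⟩ | ⟨c, hc⟩) | ⟨i', hi', hx⟩
  · simp [hj] at hx
  · obtain ⟨rfl⟩ : i = i' := by simpa [hj] using hx
    obtain ⟨-, j', hj', hall⟩ := hi
    have := hi'.2 j' hj'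
    simp [hall] at this
  · simp [hj, Constants.term] at hc
  · obtain ⟨rfl⟩ : i = i' := by simpa [hj] using hx
    have h1 : p.quant i = .ex := hi.1
    have h2 : p.quant i = .all := hi'
    simp [h1] at h2

/-! ### Flexible predicates and their new interpretation -/

/-- The predicates that are reinterpreted: the existential ones of arity at least two. -/
def IsFlexible {k : ℕ} (R : L.Relations k) : Prop := 2 ≤ k ∧ p.IsExistential R

/-- Literals of the matrix over a reinterpreted predicate. -/
def IsFlexibleLiteral (l : Literal L α p.n) : Prop :=
  ∃ (k : ℕ) (R : L.Relations k) (ts : Fin k → L.Term (α ⊕ Fin p.n)),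
    l.pred = .rel R ts ∧ p.IsFlexible R

open Classical in
/-- A literal over a reinterpreted predicate in the clause number `c`, if there is one. -/
noncomputable def chosen (c : Fin p.matrix.length) : Option (Literal L α p.n) :=
  if h : ∃ l ∈ p.matrix.get c, p.IsFlexibleLiteral l then some h.choose else none

theorem chosen_eq_some {c : Fin p.matrix.length} {l : Literal L α p.n} (h : p.chosen c = some l) :
    l ∈ p.matrix.get c ∧ p.IsFlexibleLiteral l := by
  unfold chosen at h
  split_ifs at h with h'
  obtain rfl := Option.some.inj h
  exact h'.choose_spec

theorem chosen_eq_none {c : Fin p.matrix.length} (h : p.chosen c = none) :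
    ∀ l ∈ p.matrix.get c, ¬ p.IsFlexibleLiteral l := by
  unfold chosen at h
  split_ifs at h with h'
  exact fun l hl hf => h' ⟨l, hl, hf⟩

/-- The unary predicates that occur in the matrix. -/
def Unary : Set (L.Relations 1) := {R | ∃ ts, p.Occurs (.rel R ts)}

/-- The matrix is a finite list, whereas the vocabulary may have infinitely many unary predicates.
This bounds the number of unary types independently of `M`. -/
theorem finite_unary : p.Unary.Finite := by
  classical
  let g : Literal L α p.n → Option (L.Relations 1) := fun l =>
    match l.pred with
    | .rel (k := 1) R _ => some R
    | _ => none
  refine ((p.matrix.flatten.filterMap g).finite_toSet).subset ?_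
  rintro R ⟨ts, c, b, h⟩
  simp only [Set.mem_ofPred_eq, List.mem_filterMap, List.mem_flatten]
  exact ⟨_, ⟨_, List.get_mem _ _, h⟩, rfl⟩

/-- The predicates in the matrix that are true of `m`, among the unary ones. -/
def unaryType {M : Type*} [L.Structure M] (m : M) : Set p.Unary :=
  {R | Structure.RelMap R.1 ![m]}

/-- Assignments of the bound variables whose values at the variables of the leftmost existential
block are given by `z`, those at `EUc` by `e`, and those at `EU` are in `S`. -/
structure Admissible {M : Type*} (z e : Fin p.n → M) (S : Set M) (y : Fin p.n → M) : Prop where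
  leftmost : ∀ i ∈ p.Leftmost, y i = z i
  fresh : ∀ i ∈ p.EUc, y i = e i
  rep : ∀ i ∈ p.EU, y i ∈ S

/-- The tuples at which a reinterpreted predicate is true. -/
def FlexRel {M : Type*} [L.Structure M] (a : α → M) (z e : Fin p.n → M) (S : Set M)
    {k : ℕ} (R : L.Relations k) (b : Fin k → M) : Prop :=
  ∃ c ts, p.chosen c = some ⟨.rel R ts, true⟩ ∧
    ∃ y, p.Admissible z e S y ∧ ∀ j, b j = (ts j).realize (Sum.elim a y)

/-! ### Truth of the matrix after reinterpretation -/

section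

variable {p} {M : Type*} [L.Structure M] [∀ k, IsEmpty (L.Functions (k + 1))]
  {a : α → M} {z e : Fin p.n → M} {S : Set M}

/-- A non-universal argument evaluates into `a`, `z`, the constants, `S`, or to `e j` with `j ≠ i`,
all of which `e i` avoids. Universal arguments are excluded because they may take the value `e i`.
-/
theorem fresh_ne_realize (he : Function.Injective e) (heS : ∀ i, e i ∉ S)
    (hea : ∀ i x, e i ≠ a x) (hez : ∀ i j, e i ≠ z j) (hec : ∀ i (c : L.Constants), e i ≠ (c : M))
    {y : Fin p.n → M} (hy : p.Admissible z e S y) {i : Fin p.n} {t : L.Term (α ⊕ Fin p.n)}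
    (hti : t ≠ .var (.inr i)) (htu : ¬ p.IsUnivArg t) : e i ≠ t.realize (Sum.elim a y) := by
  rcases p.isFreeArg_or_isUnivArg_or_isExArg t with
    (⟨x, rfl⟩ | ⟨j, hj, rfl⟩ | ⟨c, rfl⟩) | h | ⟨j, hj, rfl⟩
  · simpa using hea i x
  · simpa [hy.leftmost j hj] using hez i j
  · simpa using hec i c
  · exact absurd h htu
  · by_cases hU : j ∈ p.EU
    · intro h
      refine heS i ?_
      rw [h]
      simpa using hy.rep j hU
    · have hij : i ≠ j := fun h => hti (by rw [h])
      simpa [hy.fresh j ⟨hj, hU⟩] using fun h => hij (he h)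

/-- A variable `i` of `EUc` has the value `e i` under every admissible assignment, so `y` and `y'`
need not be related. -/
theorem realize_ne_of_distinguishable (he : Function.Injective e) (heS : ∀ i, e i ∉ S)
    (hea : ∀ i x, e i ≠ a x) (hez : ∀ i j, e i ≠ z j) (hec : ∀ i (c : L.Constants), e i ≠ (c : M))
    {y y' : Fin p.n → M} (hy : p.Admissible z e S y) (hy' : p.Admissible z e S y')
    {i : Fin p.n} (hi : i ∈ p.EUc) {k : ℕ} {ts ts' : Fin k → L.Term (α ⊕ Fin p.n)}
    (h : p.Distinguishable i ts ts') :
    ∃ j, (ts j).realize (Sum.elim a y) ≠ (ts' j).realize (Sum.elim a y') := by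
  obtain ⟨j, ⟨h1, h2, h3⟩ | ⟨h1, h2, h3⟩⟩ := h <;> refine ⟨j, ?_⟩
  · simpa [h1, hy.fresh i hi] using fresh_ne_realize he heS hea hez hec hy' h2 h3
  · simpa [h1, hy'.fresh i hi] using (fresh_ne_realize he heS hea hez hec hy h2 h3).symm

variable {N : Type*} [L.Structure N] {ι : N → M}

theorem map_realize_term (hι : ∀ c : L.Constants, ι (c : N) = c) {β : Type*} (v : β → N)
    (t : L.Term β) : ι (t.realize v) = t.realize (ι ∘ v) := by
  match t with
  | .var x => rfl
  | .func (l := 0) c ts =>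
    obtain rfl : ts = default := Subsingleton.elim _ _
    exact (congrArg ι (Term.realize_constants (c := c) (v := v))).trans
      ((hι c).trans (Term.realize_constants (c := c) (v := ι ∘ v)).symm)
  | .func (l := k + 1) f _ => exact isEmptyElim f

/-- The construction: if `N` carries the original interpretation of the rigid predicates and the
new one of the flexible predicates, then the matrix is true in `N` at `y`, provided that it is true
in `M` at an assignment `x` that `y` follows. -/
theorem realize_matrix {σ : Set L.Symbols} (hp : p.IsEDP σ)
    (he : Function.Injective e) (heS : ∀ i, e i ∉ S)
    (hea : ∀ i x, e i ≠ a x) (hez : ∀ i j, e i ≠ z j) (hec : ∀ i (c : L.Constants), e i ≠ (c : M))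
    (hinj : Function.Injective ι) (hι : ∀ c : L.Constants, ι (c : N) = c)
    (hrigid : ∀ {k : ℕ} (R : L.Relations k), ¬ p.IsFlexible R → ∀ b : Fin k → N,
      Structure.RelMap R b ↔ Structure.RelMap R (ι ∘ b))
    (hflex : ∀ {k : ℕ} (R : L.Relations k), p.IsFlexible R → ∀ b : Fin k → N,
      Structure.RelMap R b ↔ p.FlexRel a z e S R (ι ∘ b))
    {a' : α → N} (ha' : ι ∘ a' = a) {x : Fin p.n → M} {y : Fin p.n → N}
    (hy : p.Admissible z e S (ι ∘ y)) (hx : ∀ i ∈ p.Leftmost, x i = z i)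
    (hAV : ∀ i ∈ p.AV, x i = ι (y i))
    (hEU : ∀ i ∈ p.EU, p.unaryType (ι (y i)) = p.unaryType (x i))
    (h : (matrixFormula p.matrix).Realize a x) : (matrixFormula p.matrix).Realize a' y := by
  rw [realize_matrixFormula] at h ⊢
  have hterm : ∀ t : L.Term (α ⊕ Fin p.n),
      ι (t.realize (Sum.elim a' y)) = t.realize (Sum.elim a (ι ∘ y)) := by
    intro t
    rw [map_realize_term hι, ← ha', Sum.comp_elim]
  have hsame : ∀ t : L.Term (α ⊕ Fin p.n), p.IsFreeArg t ∨ p.IsUnivArg t →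
      ι (t.realize (Sum.elim a' y)) = t.realize (Sum.elim a x) := by
    intro t ht
    rw [hterm]
    rcases ht with (⟨x', rfl⟩ | ⟨j, hj, rfl⟩ | ⟨c, rfl⟩) | ⟨j, hj, rfl⟩
    · simp
    · simpa [hx j hj] using hy.leftmost j hj
    · simp
    · simpa using (hAV j hj).symm
  intro C hC
  obtain ⟨c, rfl⟩ := List.get_of_mem hC
  cases hch : p.chosen c with
  | some l =>
    obtain ⟨hl, k, R, ts, hlR, hR⟩ := p.chosen_eq_some hch
    refine ⟨l, hl, ?_⟩
    obtain ⟨pred, pol⟩ := l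
    obtain rfl : pred = _ := hlR
    cases pol with
    | true =>
      change Structure.RelMap R (fun j => (ts j).realize (Sum.elim a' y))
      exact (hflex R hR _).2 ⟨c, ts, hch, ι ∘ y, hy, fun j => hterm _⟩
    | false =>
      change ¬ Structure.RelMap R (fun j => (ts j).realize (Sum.elim a' y))
      rw [hflex R hR]
      -- The tuple would be forced by a positive choice in `c'`. One literal is chosen per clause,
      -- so `c' ≠ c`, and the distinguishability condition applies.
      rintro ⟨c', ts', hch', y', hy', hj⟩
      have hne : c' ≠ c := by
        rintro rfl
        simp [hch] at hch'
      obtain ⟨i, hi, hd⟩ := hp.distinguishable k R hR.1 hR.2 c' c ts' ts hne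
        (p.chosen_eq_some hch').1 hl
      obtain ⟨j, hj'⟩ := realize_ne_of_distinguishable he heS hea hez hec hy' hy hi hd
      exact hj' ((hj j).symm.trans (hterm (ts j)))
  | none =>
    obtain ⟨l, hl, hlx⟩ := h _ hC
    refine ⟨l, hl, ?_⟩
    have hrig := p.chosen_eq_none hch l hl
    obtain ⟨pred, pol⟩ := l
    have key : pred.toFormula.Realize a' y ↔ pred.toFormula.Realize a x := by
      cases pred with
      | eq s t =>
        have := hp.eq_freeOrUniv s t ⟨c, pol, hl⟩
        change s.realize (Sum.elim a' y) = t.realize (Sum.elim a' y) ↔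
          s.realize (Sum.elim a x) = t.realize (Sum.elim a x)
        rw [← hinj.eq_iff, hsame s this.1, hsame t this.2]
      | @rel k R ts =>
        have hR : ¬ p.IsFlexible R := fun hR => hrig ⟨k, R, ts, rfl, hR⟩
        change Structure.RelMap R (fun j => (ts j).realize (Sum.elim a' y)) ↔
          Structure.RelMap R (fun j => (ts j).realize (Sum.elim a x))
        rw [hrigid R hR]
        by_cases hall : ∀ j, p.IsFreeArg (ts j) ∨ p.IsUnivArg (ts j)
        · have : (ι ∘ fun j => (ts j).realize (Sum.elim a' y)) =
              fun j => (ts j).realize (Sum.elim a x) := funext fun j => hsame _ (hall j)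
          rw [this]
        -- A rigid predicate with an existential argument must be unary; only equality of unary
        -- types is then needed.
        · have hex : p.IsExistential R := by
            by_contra hne
            exact hall (p.isFreeOrUniv_of_not_isExistential hne ts ⟨c, pol, hl⟩)
          push Not at hall
          obtain ⟨j, hj1, hj2⟩ := hall
          have hk : k = 1 := by
            have := j.2
            have : ¬ 2 ≤ k := fun h => hR ⟨h, hex⟩
            omega
          subst hk
          obtain rfl : j = 0 := Subsingleton.elim _ _
          obtain ⟨i, hi, hti⟩ := ((p.isFreeArg_or_isUnivArg_or_isExArg (ts 0)).resolve_left
            hj1).resolve_left hj2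
          have hEUi : i ∈ p.EU := ⟨hi, R, ts, ⟨c, pol, hl⟩, hti⟩
          have := Set.ext_iff.1 (hEU i hEUi) ⟨R, ts, c, pol, hl⟩
          simp only [unaryType, Set.mem_ofPred_eq] at this
          have e1 : (ι ∘ fun j => (ts j).realize (Sum.elim a' y)) = ![ι (y i)] := by
            funext j
            obtain rfl : j = 0 := Subsingleton.elim _ _
            simp [hti]
          have e2 : (fun j => (ts j).realize (Sum.elim a x)) = ![x i] := by
            funext j
            obtain rfl : j = 0 := Subsingleton.elim _ _
            simp [hti]
          rw [e1, e2]
          exact this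
    cases pol with
    | true => exact key.2 hlx
    | false => exact fun hn => hlx (key.1 hn)

end

/-! ### The reinterpreted substructure is a model -/

/-- Representatives of the realized unary types. -/
noncomputable def representative {M : Type*} [L.Structure M] [Nonempty M] (τ : Set p.Unary) : M :=
  Classical.epsilon fun m => p.unaryType m = τ

theorem unaryType_representative {M : Type*} [L.Structure M] [Nonempty M] (m : M) :
    p.unaryType (p.representative (p.unaryType m) : M) = p.unaryType m :=
  Classical.epsilon_spec (p := fun m' : M => p.unaryType m' = p.unaryType m) ⟨m, rfl⟩

open Classical in
/-- The reinterpretation of the flexible predicates on a substructure. -/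
@[reducible] noncomputable def reinterpretation {M : Type*} [L.Structure M] (a : α → M) (z e : Fin p.n → M)
    (S : Set M) (M₂ : L.Substructure M) : L.Structure M₂ where
  funMap f x := Structure.funMap f x
  RelMap R b := if p.IsFlexible R then p.FlexRel a z e S R (fun j => (b j : M))
    else Structure.RelMap R b

/-- The first `EDP` condition keeps flexible predicates out of `σ`. -/
theorem agreeOn_reinterpretation {σ : Set L.Symbols} (hp : p.IsEDP σ) {M : Type*} [L.Structure M]
    (a : α → M) (z e : Fin p.n → M) (S : Set M) (M₂ : L.Substructure M) :
    AgreeOn σ (p.reinterpretation a z e S M₂) Substructure.inducedStructure := by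
  refine ⟨fun k f _ => rfl, fun k R hR => ?_⟩
  have : ¬ p.IsFlexible R := fun h =>
    p.not_isFreeOrUniv_of_isExistential h.2 (hp.freeOrUniv k R h.1 hR)
  funext b
  exact if_neg this

/-- If `M₂` contains the values of `z`, `e` and the representatives of the unary types, then its
reinterpretation is a model. -/
theorem realize_reinterpretation [∀ k, IsEmpty (L.Functions (k + 1))] {σ : Set L.Symbols}
    (hp : p.IsEDP σ) {M : Type*} [L.Structure M] [Nonempty M] {a : α → M} {z e : Fin p.n → M}
    (he : Function.Injective e) (heS : ∀ i τ, e i ≠ p.representative τ)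
    (hea : ∀ i x, e i ≠ a x) (hez : ∀ i j, e i ≠ z j) (hec : ∀ i (c : L.Constants), e i ≠ (c : M))
    (h : QuantClosure p.n p.quant fun x =>
      (matrixFormula p.matrix).Realize a x ∧ ∀ i ∈ p.Leftmost, x i = z i)
    (M₂ : L.Substructure M) (haM : ∀ x, a x ∈ M₂) (hzM : ∀ i, z i ∈ M₂) (heM : ∀ i, e i ∈ M₂)
    (hrM : ∀ τ, p.representative τ ∈ M₂) :
    @Formula.Realize L M₂ (p.reinterpretation a z e (Set.range p.representative) M₂) α
      p.toFormula (fun x => ⟨a x, haM x⟩) := by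
  classical
  refine (@realize_closeWith L α M₂ (p.reinterpretation a z e (Set.range p.representative) M₂)
    _ _ _ _).2 ?_
  -- `G i m` is the answer in `M₂` to the witness `m` in `M`; it depends on `m` only through its
  -- unary type.
  let G : Fin p.n → M → M₂ := fun i m =>
    if i ∈ p.Leftmost then ⟨z i, hzM i⟩ else if i ∈ p.EU then ⟨_, hrM (p.unaryType m)⟩
    else ⟨e i, heM i⟩
  refine QuantClosure.transfer (fun i (m : M) (y : M₂) => if p.quant i = .all then m = y else y = G i m)
    (fun i hi y => ⟨y, by simp [hi]⟩) (fun i hi x => ⟨G i x, by simp [hi]⟩)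
    (fun x y hxy hx => ?_) h
  have hG : ∀ i, p.quant i = .ex → y i = G i (x i) := by
    intro i hi
    simpa [hi] using hxy i
  have hL : ∀ i ∈ p.EV, i ∉ p.Leftmost := by
    rintro i ⟨-, j, hj, hall⟩ hi
    have := hi.2 j hj
    simp [hall] at this
  refine @realize_matrix L α p M _ _ a z e (Set.range p.representative) M₂
    (p.reinterpretation a z e (Set.range p.representative) M₂) Subtype.val σ hp he
    ?_ hea hez hec Subtype.val_injective ?_ ?_ ?_ _ rfl x y ⟨?_, ?_, ?_⟩ hx.2 ?_ ?_ hx.1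
  · rintro i ⟨τ, hτ⟩
    exact heS i τ hτ.symm
  · intro c
    change Structure.funMap c _ = Structure.funMap c _
    exact congrArg _ (Subsingleton.elim _ _)
  · intro k R hR b
    exact iff_of_eq (if_neg hR)
  · intro k R hR b
    exact iff_of_eq (if_pos hR)
  · intro i hi
    simp [hG i hi.1, G, hi]
  · intro i hi
    simp [hG i hi.1.1, G, hL i hi.1, hi.2]
  · intro i hi
    simp [hG i hi.1.1, G, hL i hi.1, hi]
  · intro i hi
    have hi' : p.quant i = .all := hi
    simpa [hi'] using hxy i
  · intro i hi
    simp [hG i hi.1.1, G, hL i hi.1, hi, unaryType_representative]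

end PCNF

end FirstOrder.Language

/-! ### The bounded core and the conclusion -/

open FirstOrder Language in
theorem FirstOrder.Language.PCNF.toFormula_mem_EBS {L : FirstOrder.Language.{u, v}}
    [∀ k, IsEmpty (L.Functions (k + 1))] [Finite L.Constants] {α : Type w} [Finite α]
    {σ : Set L.Symbols} (p : PCNF L α) (hp : p.IsEDP σ) :
    p.toFormula ∈ EBS.{u, v, w, z} L σ α := by
  have : Finite p.Unary := p.finite_unary
  -- `T` indexes the elements that fresh ones must avoid; the bound adds `p.n` for the fresh ones.
  let T := (Set p.Unary ⊕ α) ⊕ (Fin p.n ⊕ L.Constants)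
  refine ⟨Nat.card T + p.n, fun M _ _ a hφ => ?_⟩
  by_cases hM : (Set.univ : Set M).encard ≤ (Nat.card T + p.n : ℕ)
  · refine ⟨⊤, fun _ => trivial, ⟨Classical.arbitrary M, trivial⟩, by simpa using hM,
      fun M₂ h => ?_⟩
    obtain rfl : M₂ = ⊤ := top_le_iff.1 h
    refine ⟨Substructure.inducedStructure, ⟨fun _ _ _ => rfl, fun _ _ _ => rfl⟩, ?_⟩
    rw [← StrongHomClass.realize_formula (Substructure.topEquiv (L := L) (M := M))]
    exact hφ
  obtain ⟨z, hz⟩ := ((realize_closeWith a p.quant _).1 hφ).exists_leftmost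
  let f : T → M := Sum.elim (Sum.elim p.representative a) (Sum.elim z fun c : L.Constants => (c : M))
  obtain ⟨e, he, hef⟩ := exists_injective_avoiding f p.n hM
  let M₁ : L.Substructure M :=
    { carrier := Set.range f ∪ Set.range e
      fun_mem := by
        intro k g x _
        cases k with
        | zero =>
          refine .inl ⟨.inr (.inr g), ?_⟩
          exact congrArg (Structure.funMap g) (Subsingleton.elim _ _)
        | succ k => exact isEmptyElim g }
  have hfM : ∀ t, f t ∈ M₁ := fun t => .inl ⟨t, rfl⟩
  -- Even if the type `∅` is not realized, its `representative` is some element of `M`, which makes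
  -- `M₁` nonempty.
  refine ⟨M₁, fun x => hfM (.inl (.inr x)), ⟨_, hfM (.inl (.inl ∅))⟩, ?_, fun M₂ h => ?_⟩
  · refine (Set.encard_union_le _ _).trans ?_
    push_cast
    refine add_le_add ?_ ?_
    · rw [← Set.image_univ, ← ENat.card_eq_coe_natCard, ← Set.encard_univ]
      exact Set.encard_image_le _ _
    · rw [← Set.image_univ]
      refine (Set.encard_image_le _ _).trans ?_
      simp [Set.encard_univ]
  · exact ⟨_, p.agreeOn_reinterpretation hp a z e (Set.range p.representative) M₂,
      p.realize_reinterpretation hp he (fun i τ => hef i (.inl (.inl τ)))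
        (fun i x => hef i (.inl (.inr x))) (fun i j => hef i (.inr (.inl j)))
        (fun i c => hef i (.inr (.inr c))) hz M₂ _ (fun i => h (hfM (.inr (.inl i))))
        (fun i => h (.inr ⟨i, rfl⟩)) (fun τ => h (hfM (.inl (.inl τ))))⟩

theorem mainTheorem2 (L : FirstOrder.Language.{u, v})
    [∀ k, IsEmpty (L.Functions (k + 1))] [Finite L.Constants]
    (α : Type w) [Finite α] (σ : Set L.Symbols) :
    L.EDP σ α ⊆ FirstOrder.Language.EBS.{u, v, w, z} L σ α := by
  rintro _ ⟨p, rfl, hp⟩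
  exact p.toFormula_mem_EBS hp
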